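/- Let $K$ be a field of characteristic $0$ (for instance $\mathbb C$), let $d$ be odd and $N\ge 0$, and let $R=K[t_1,\dots,t_N,u_1,\dots,u_N,v_1,\dots,v_N,\dots]$ be the polynomial ring in $dN$ variables, one group of $N$ variables for each of the $d$ coordinate directions; the index $i=1,\dots,N$ labels the particles, and the grade of a polynomial is its total degree. Let $S\subset R$ be the subalgebra of the polynomials that are symmetric in each of the $d$ groups of variables separately, $S_+\subset S$ the ideal of those with zero constant term, and $A\subset R$ the $S$-module of the diagonally antisymmetric polynomials, i.e. those that are multiplied by $\operatorname{sgn}\sigma$ when the particle labels are permuted by $\sigma$ in all groups simultaneously. A system of shapes is a basis of the $S$-module $A$ that consists of homogeneous polynomials; its members are called shapes. Let $$\Delta=\Delta_N(t)\,\Delta_N(u)\,\Delta_N(v)\cdots$$ be the product over the $d$ directions of the Vandermonde determinants. Then finite systems of shapes exist, so $A$ is a free $S$-module. Every system of shapes has exactly one member $\Psi$ of grade $dN(N-1)/2$, and all its other members have strictly smaller grade. This highest-graded shape is the product of Vandermonde determinants, up to a nonzero scalar factor and excitations of shapes: there is $c\in K\setminus\{0\}$ with $\Psi-c\,\Delta\in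 S_+A$. Moreover, replacing $\Psi$ by $\Delta$ and keeping all the other members gives again a system of shapes. -/

import Mathlib

open MvPolynomial

namespace FermionShapes

/-- Formal-power wave functions of `N` particles in `d` dimensions: polynomials in the variables
`X (a, i)`, the `a`-th Cartesian coordinate of the `i`-th particle. A single-particle state is
represented by a monomial, and the grade (number of nodes) is the degree. -/
abbrev Wave (K : Type*) [Field K] (d N : ℕ) : Type _ := MvPolynomial (Fin d × Fin N) K

/-- Permute the `a`-th coordinates of the particles, leaving all the other coordinates alone. -/
def permCoord {d N : ℕ} (a : Fin d) (σ : Equiv.Perm (Fin N)) (x : Fin d × Fin N) :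
    Fin d × Fin N :=
  (x.1, if x.1 = a then σ x.2 else x.2)

/-- Permute the particles, that is, the vector coordinates `r_i`. -/
def permParticle {d N : ℕ} (σ : Equiv.Perm (Fin N)) (x : Fin d × Fin N) : Fin d × Fin N :=
  (x.1, σ x.2)

/-- The algebra of polynomials symmetric in each coordinate direction separately. -/
def sepSymm (K : Type*) [Field K] (d N : ℕ) : Subalgebra K (Wave K d N) where
  carrier := {p | ∀ (a : Fin d) (σ : Equiv.Perm (Fin N)), rename (permCoord a σ) p = p}
  mul_mem' hp hq a σ := by rw [map_mul, hp a σ, hq a σ]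
  add_mem' hp hq a σ := by rw [map_add, hp a σ, hq a σ]
  algebraMap_mem' r a σ := (rename (permCoord a σ)).commutes r

theorem rename_permParticle_of_mem {K : Type*} [Field K] {d N : ℕ} {p : Wave K d N}
    (hp : p ∈ sepSymm K d N) (σ : Equiv.Perm (Fin N)) : rename (permParticle σ) p = p := by
  classical
  have key : ∀ s : Finset (Fin d),
      rename (fun x : Fin d × Fin N => (x.1, if x.1 ∈ s then σ x.2 else x.2)) p = p := by
    intro s
    induction s using Finset.induction_on with
    | empty =>
      have h : (fun x : Fin d × Fin N => (x.1, if x.1 ∈ (∅ : Finset (Fin d)) then σ x.2 else x.2))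
          = id := by
        funext x
        simp
      rw [h, rename_id_apply]
    | insert a s ha ih =>
      have h : (fun x : Fin d × Fin N => (x.1, if x.1 ∈ insert a s then σ x.2 else x.2))
          = permCoord a σ ∘
            (fun x : Fin d × Fin N => (x.1, if x.1 ∈ s then σ x.2 else x.2)) := by
        funext x
        by_cases hx : x.1 = a
        · simp [permCoord, hx, ha]
        · simp [permCoord, hx]
      rw [h, ← rename_rename, ih]
      exact hp a σ
  have h := key Finset.univ
  simp only [Finset.mem_univ, if_true] at h
  exact h

/-- The module, over the polynomials symmetric in each direction separately, of the polynomials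
that are antisymmetric under permutations of the particles (diagonally antisymmetric). -/
def antisymm (K : Type*) [Field K] (d N : ℕ) : Submodule (sepSymm K d N) (Wave K d N) where
  carrier := {p | ∀ σ : Equiv.Perm (Fin N),
    rename (permParticle σ) p = C ((Equiv.Perm.sign σ : ℤ) : K) * p}
  add_mem' hp hq σ := by rw [map_add, hp σ, hq σ, mul_add]
  zero_mem' σ := by rw [map_zero, mul_zero]
  smul_mem' c p hp σ := by
    rw [Algebra.smul_def, map_mul, hp σ]
    change rename (permParticle σ) (c : Wave K d N) * _ = _ * ((c : Wave K d N) * p)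
    rw [rename_permParticle_of_mem c.2 σ, mul_left_comm]

/-- A system of shapes: a basis, consisting of homogeneous polynomials, of the module of
diagonally antisymmetric polynomials over the polynomials symmetric in each direction. -/
def IsShapeSystem {K : Type*} [Field K] {d N : ℕ} {ι : Type*}
    (Ψ : Module.Basis ι (sepSymm K d N) (antisymm K d N)) : Prop :=
  ∀ i, ∃ n : ℕ, (Ψ i : Wave K d N).IsHomogeneous n

/-- The elements of `sepSymm K d N` with zero constant term. -/
noncomputable def sepSymmPos (K : Type*) [Field K] (d N : ℕ) : Ideal (sepSymm K d N) :=
  RingHom.ker ((constantCoeff (R := K) (σ := Fin d × Fin N)).comp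
    (sepSymm K d N).val.toRingHom)

/-- The finite sums of products `Φ * Ψ` with `Ψ` diagonally antisymmetric and `Φ` symmetric in
each direction and without constant term. -/
noncomputable def excitations (K : Type*) [Field K] (d N : ℕ) : Submodule (sepSymm K d N) (Wave K d N) :=
  sepSymmPos K d N • antisymm K d N

/-- The product over the dimensions of the Vandermonde determinants. -/
noncomputable def vandermondeProd (K : Type*) [Field K] (d N : ℕ) : Wave K d N :=
  ∏ a : Fin d, (Matrix.vandermonde fun i : Fin N => (X (a, i) : Wave K d N)).det

/-!
Let `R = Wave K d N`, `S = sepSymm K d N`, `A = antisymm K d N` and `Δ = vandermondeProd K d N`.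
Each `X (a, i)` is a root of `∏ j ≤ i, (T - X (a, j))`, so the staircase monomials, in which the
exponent of `X (a, i)` is at most `i`, span `R` over `S`. There are as many of them as separate
permutations of the coordinates, and these permutations are independent characters of `R` over
`S`, so a spanning family of that size is a basis of `R`. By the graded Nakayama lemma, any
homogeneous spanning set of `R` over `K` contains an `S`-basis of `R`; choosing its members in `A`
or in the kernel of the antisymmetrizer yields a homogeneous basis of `A`. The antisymmetrizer
also gives `S₊A = S₊R ∩ A`, so that the coordinates of `x ∈ A` all lie in `S₊` only if `x ∈ S₊R`.

The staircase monomials show that `R / S₊R` vanishes above degree `dN(N-1)/2` and is at most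
one-dimensional in that degree. It is spanned there by `Δ`: a polynomial alternating in each
direction has no monomial of degree below `dN(N-1)/2`, whereas `Δ ∈ S₊R` would, after separate
antisymmetrization, put `Δ` into `S₊` times such polynomials and so above its own degree. A basis
member is never in `S₊R`, so its grade is at most `dN(N-1)/2`; and `Δ ∉ S₊R` has a coordinate
outside `S₊`, which by homogeneity is a nonzero scalar and belongs to a basis member of the same
grade. Any basis member of that grade is a multiple of `Δ` modulo `S₊R`, so there is only one.
-/

section Module

variable {S M ι : Type*} [CommRing S] [AddCommGroup M] [Module S M]

theorem smul_eq_smul_top_inf_of_isProj {A : Submodule S M} {e : M →ₗ[S] M}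
    (he : LinearMap.IsProj A e) (I : Ideal S) : I • A = I • ⊤ ⊓ A := by
  refine le_antisymm (le_inf (smul_mono_right I le_top) Submodule.smul_le_right) ?_
  rintro x ⟨hx, hxA⟩
  have hmap : (⊤ : Submodule S M).map e = A := by rw [Submodule.map_top, he.range]
  rw [← he.map_id x hxA, ← hmap, ← Submodule.map_smul'']
  exact Submodule.mem_map_of_mem hx

theorem exists_basis_of_isProj [Finite ι] {A : Submodule S M} {e : M →ₗ[S] M}
    (he : LinearMap.IsProj A e) (b : Module.Basis ι S M) (hb : ∀ i, b i ∈ A ∨ e (b i) = 0) :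
    ∃ (r : ℕ) (Ψ : Module.Basis (Fin r) S A), ∀ i, (Ψ i : M) ∈ Set.range b := by
  have hspan : Submodule.span S (Set.range fun i : {i // b i ∈ A} => b i) = A := by
    refine le_antisymm (Submodule.span_le.2 (by rintro _ ⟨i, rfl⟩; exact i.2)) ?_
    conv_lhs => rw [← he.range, LinearMap.range_eq_map, ← b.span_eq, Submodule.map_span]
    rw [Submodule.span_le]
    rintro _ ⟨_, ⟨i, rfl⟩, rfl⟩
    rcases hb i with hi | hi
    · rw [he.map_id _ hi]
      exact Submodule.subset_span ⟨⟨i, hi⟩, rfl⟩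
    · rw [hi]
      exact zero_mem _
  have hli : LinearIndependent S fun i : {i // b i ∈ A} => b i :=
    b.linearIndependent.comp _ Subtype.val_injective
  let Ψ := (Module.Basis.span hli).map (LinearEquiv.ofEq _ _ hspan)
  let σ := Finite.equivFin {i // b i ∈ A}
  refine ⟨_, Ψ.reindex σ, fun i => ⟨σ.symm i, ?_⟩⟩
  rw [Module.Basis.reindex_apply]
  exact (congrArg Subtype.val (Module.Basis.span_apply hli _)).symm

theorem exists_basis_replace (b : Module.Basis ι S M) (i : ι) {v : M} (hv : IsUnit (b.repr v i)) :
    ∃ b' : Module.Basis ι S M, b' i = v ∧ ∀ j, j ≠ i → b' j = b j := by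
  classical
  obtain ⟨u, hu⟩ := hv
  have h_coord : b.coord i (u⁻¹ • v - b i) = 0 := by
    simp [Units.smul_def, ← hu]
  refine ⟨(b.map (LinearEquiv.transvection h_coord)).unitsSMul (Function.update 1 i u), ?_,
    fun j hj => ?_⟩
  · rw [Module.Basis.unitsSMul_apply, Module.Basis.map_apply]
    simp [LinearMap.transvection.apply]
  · rw [Module.Basis.unitsSMul_apply, Module.Basis.map_apply]
    simp [LinearMap.transvection.apply, hj]

theorem forall_repr_mem_iff_of_isProj {A : Submodule S M} {e : M →ₗ[S] M}
    (he : LinearMap.IsProj A e) (Ψ : Module.Basis ι S A) {I : Ideal S} {x : A} :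
    (∀ i, Ψ.repr x i ∈ I) ↔ (x : M) ∈ I • (⊤ : Submodule S M) := by
  have hmem : (x : M) ∈ I • (⊤ : Submodule S M) ↔ x ∈ I • (⊤ : Submodule S A) := by
    rw [Submodule.mem_smul_top_iff, smul_eq_smul_top_inf_of_isProj he, Submodule.mem_inf,
      and_iff_left x.2]
  rw [hmem]
  refine ⟨fun h => ?_, fun h i => ?_⟩
  · rw [← Ψ.linearCombination_repr x]
    exact sum_mem fun i _ => Submodule.smul_mem_smul (h i) Submodule.mem_top
  · simpa using Submodule.smul_top_le_comap_smul_top I (Ψ.coord i) h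

theorem mul_repr_mem_of_basis_sub_smul_mem {A : Submodule S M} {e : M →ₗ[S] M}
    (he : LinearMap.IsProj A e) (Ψ : Module.Basis ι S A) {I : Ideal S} {i j : ι} (hij : j ≠ i)
    {u : S} {x : A} (h : (Ψ j : M) - u • (x : M) ∈ I • (⊤ : Submodule S M)) :
    u * Ψ.repr x i ∈ I := by
  classical
  have hrepr := (forall_repr_mem_iff_of_isProj he Ψ (x := Ψ j - u • x)).2 h i
  simpa [hij] using hrepr

theorem repr_eq_of_coe_eq_sum {A : Submodule S M} (Ψ : Module.Basis ι S A) {x : A} {T : Finset ι}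
    {s : ι → S} (h : (x : M) = ∑ j ∈ T, s j • (Ψ j : M)) {i : ι} (hi : i ∈ T) :
    Ψ.repr x i = s i := by
  classical
  have hx : x = ∑ j ∈ T, s j • Ψ j := Subtype.ext (by simpa using h)
  rw [hx, map_sum, Finsupp.finsetSum_apply]
  simp [Finsupp.single_apply, hi]

theorem coe_eq_sum_repr {A : Submodule S M} (Ψ : Module.Basis ι S A) (x : A) :
    (x : M) = ∑ j ∈ (Ψ.repr x).support, Ψ.repr x j • (Ψ j : M) := by
  conv_lhs => rw [← Ψ.linearCombination_repr x, Finsupp.linearCombination_apply, Finsupp.sum]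
  simp

end Module

section Galois

variable {S R G ι : Type*} [CommRing S] [CommRing R] [IsDomain R] [Algebra S R]

theorem linearIndependent_algHom_apply {φ : G → R →ₐ[S] R} (hφ : Function.Injective φ)
    {h : ι → R} (hh : Submodule.span S (Set.range h) = ⊤) :
    LinearIndependent R fun g i => φ g (h i) := by
  let restrict : (R →ₗ[S] R) →ₗ[R] (ι → R) :=
    { toFun := fun f i => f (h i)
      map_add' := fun _ _ => rfl
      map_smul' := fun _ _ => rfl }
  have hinj : LinearMap.ker restrict = ⊥ := LinearMap.ker_eq_bot'.2 fun f hf =>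
    LinearMap.ext_on hh (by rintro _ ⟨i, rfl⟩; exact congrFun hf i)
  exact ((linearIndependent_toLinearMap S R R).comp φ hφ).map' restrict hinj

/- The `φ g` are independent characters, so the matrix `φ g (h i)` is square and nonsingular; a
relation among the `h i` would be a relation among its columns. -/
theorem linearIndependent_of_span_eq_top [FaithfulSMul S R] [Fintype G] [Fintype ι]
    {φ : G → R →ₐ[S] R} (hφ : Function.Injective φ) {h : ι → R}
    (hh : Submodule.span S (Set.range h) = ⊤) (hcard : Fintype.card ι ≤ Fintype.card G) :
    LinearIndependent S h := by
  classical
  have hrows := linearIndependent_algHom_apply hφ hh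
  have hcard' : Fintype.card ι = Fintype.card G :=
    hcard.antisymm (by simpa using hrows.fintype_card_le_finrank)
  let e : ι ≃ G := Fintype.equivOfCardEq hcard'
  let A : Matrix ι ι R := .of fun j i => φ (e j) (h i)
  have hdet : A.det ≠ 0 := fun h0 => by
    obtain ⟨v, hv, hvA⟩ := Matrix.exists_vecMul_eq_zero_iff.2 h0
    refine hv (funext (Fintype.linearIndependent_iff.1 (hrows.comp e e.injective) v ?_))
    rw [← hvA, Matrix.vecMul_eq_sum]
    rfl
  have hcols : LinearIndependent S A.col :=
    (Matrix.linearIndependent_cols_of_det_ne_zero hdet).restrict_scalars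
      (by simpa [Algebra.smul_def] using FaithfulSMul.algebraMap_injective S R)
  exact hcols.of_comp (LinearMap.pi fun j => (φ (e j)).toLinearMap)

end Galois

section Tower

variable {S R ι α : Type*} [CommRing S] [CommRing R] [Algebra S R]

theorem toSubmodule_sup_adjoin_singleton_le (B : Subalgebra S R) {x : R} {f : Polynomial R}
    (hf : f.Monic) (hx : f.IsRoot x) (hcoeff : ∀ k, f.coeff k ∈ B) :
    Subalgebra.toSubmodule (B ⊔ Algebra.adjoin S {x}) ≤
      Subalgebra.toSubmodule B * Submodule.span S ((x ^ ·) '' Set.Iio f.natDegree) := by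
  obtain ⟨q, hq, hdeg, hmonic⟩ := Polynomial.lifts_and_natDegree_eq_and_monic
    (f := algebraMap B R) ((Polynomial.lifts_iff_coeff_lifts _).2 fun k => ⟨⟨_, hcoeff k⟩, rfl⟩) hf
  have hspan := Submodule.span_range_natDegree_eq_adjoin (x := x) hmonic
    (by rw [Polynomial.aeval_def, ← Polynomial.eval_map, hq, hx])
  classical
  have hle : B ⊔ Algebra.adjoin S {x} ≤ (Algebra.adjoin B {x}).restrictScalars S :=
    sup_le (fun b hb => (Algebra.adjoin B {x}).algebraMap_mem ⟨b, hb⟩)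
      (Algebra.adjoin_le (Set.singleton_subset_iff.2 (Algebra.self_mem_adjoin_singleton B x)))
  intro y hy
  have hyB : y ∈ Algebra.adjoin B {x} := hle hy
  rw [← Subalgebra.mem_toSubmodule, ← hspan] at hyB
  clear hy
  induction hyB using Submodule.span_induction with
  | mem y hy =>
    obtain ⟨k, hk, rfl⟩ := Finset.mem_image.1 (Finset.mem_coe.1 hy)
    rw [← one_mul (x ^ k)]
    exact Submodule.mul_mem_mul B.one_mem
      (Submodule.subset_span ⟨k, hdeg ▸ Finset.mem_range.1 hk, rfl⟩)
  | zero => exact zero_mem _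
  | add y z _ _ hy hz => exact add_mem hy hz
  | smul b y _ hy =>
    rw [← Subalgebra.isIdempotentElem_toSubmodule B, mul_assoc, Algebra.smul_def]
    exact Submodule.mul_mem_mul b.2 hy

theorem toSubmodule_adjoin_image_le [LinearOrder α] (x : ι → R) (f : ι → Polynomial R) (ρ : ι → α)
    (hf : ∀ t, (f t).Monic) (hx : ∀ t, (f t).IsRoot (x t))
    (hcoeff : ∀ t k, (f t).coeff k ∈ Algebra.adjoin S (x '' {u | ρ u < ρ t}))
    (s : Finset ι) (hs : ∀ t ∈ s, ∀ u, ρ u < ρ t → u ∈ s) :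
    Subalgebra.toSubmodule (Algebra.adjoin S (x '' s)) ≤
      ∏ t ∈ s, Submodule.span S ((x t ^ ·) '' Set.Iio (f t).natDegree) := by
  classical
  induction s using Finset.induction_on_max_value ρ with
  | empty => simp [Algebra.adjoin_empty, Algebra.toSubmodule_bot]
  | insert a s ha hmax ih =>
    have hs' : ∀ t ∈ s, ∀ u, ρ u < ρ t → u ∈ s := fun t ht u hu =>
      Finset.mem_of_mem_insert_of_ne (hs t (Finset.mem_insert_of_mem ht) u hu)
        (by rintro rfl; exact (hmax t ht).not_gt hu)
    have hlt : {u | ρ u < ρ a} ⊆ s := fun u hu =>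
      Finset.mem_of_mem_insert_of_ne (hs a (Finset.mem_insert_self a s) u hu)
        (by rintro rfl; exact lt_irrefl _ hu)
    have hstep := toSubmodule_sup_adjoin_singleton_le (Algebra.adjoin S (x '' s)) (hf a) (hx a)
      fun k => Algebra.adjoin_mono (Set.image_mono hlt) (hcoeff a k)
    rw [Finset.coe_insert, Set.image_insert_eq, Set.insert_eq, Set.union_comm,
      Algebra.adjoin_union, Finset.prod_insert ha, mul_comm]
    exact hstep.trans (mul_le_mul_left (ih hs') _)

theorem span_range_prod_pow_eq_top [LinearOrder α] [Fintype ι] {x : ι → R}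
    (htop : Algebra.adjoin S (Set.range x) = ⊤) {f : ι → Polynomial R} {n : ι → ℕ} (ρ : ι → α)
    (hf : ∀ t, (f t).Monic) (hn : ∀ t, (f t).natDegree = n t) (hx : ∀ t, (f t).IsRoot (x t))
    (hcoeff : ∀ t k, (f t).coeff k ∈ Algebra.adjoin S (x '' {u | ρ u < ρ t})) :
    Submodule.span S (Set.range fun e : (t : ι) → Fin (n t) => ∏ t, x t ^ (e t : ℕ)) = ⊤ := by
  obtain rfl : (fun t => (f t).natDegree) = n := funext hn
  have h := toSubmodule_adjoin_image_le x f ρ hf hx hcoeff Finset.univ (by simp)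
  rw [Finset.coe_univ, Set.image_univ, htop, Algebra.top_toSubmodule, top_le_iff,
    Submodule.prod_span] at h
  refine eq_top_iff.2 (h.ge.trans (Submodule.span_mono fun y hy => ?_))
  obtain ⟨g, hg, rfl⟩ := Set.mem_fintype_prod _ _ |>.1 hy
  choose e he hxe using hg
  exact ⟨fun t => ⟨e t, he t⟩, Finset.prod_congr rfl fun t _ => hxe t⟩

/- The complementary factor `∏ j ∉ s, (T - x j)` is monic over `B`, so dividing the full product
by it stays over `B`. -/
theorem coeff_prod_X_sub_C_mem [Fintype ι] {x : ι → R} (B : Subalgebra S R)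
    (hx : ∀ k, (∏ j, (Polynomial.X - Polynomial.C (x j))).coeff k ∈ B) (s : Finset ι)
    (hs : ∀ j ∉ s, x j ∈ B) (k : ℕ) :
    (∏ j ∈ s, (Polynomial.X - Polynomial.C (x j))).coeff k ∈ B := by
  classical
  have hx' : ∏ j, (Polynomial.X - Polynomial.C (x j)) ∈ Polynomial.lifts (algebraMap B R) :=
    (Polynomial.lifts_iff_coeff_lifts _).2 fun k => ⟨⟨_, hx k⟩, rfl⟩
  obtain ⟨F, hF⟩ := (Polynomial.mem_lifts _).1 hx'
  let G : Polynomial B := ∏ j : {j // j ∉ s}, (Polynomial.X - Polynomial.C ⟨x j, hs j j.2⟩)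
  have hGmonic : G.Monic := Polynomial.monic_prod_of_monic _ _ fun _ _ =>
    Polynomial.monic_X_sub_C _
  have hG : G.map (algebraMap B R) = ∏ j ∈ sᶜ, (Polynomial.X - Polynomial.C (x j)) := by
    rw [Polynomial.map_prod, Finset.prod_subtype sᶜ (p := (· ∉ s)) fun _ => Finset.mem_compl]
    exact Finset.prod_congr rfl fun j _ => by simp
  have hdiv : (F /ₘ G).map (algebraMap B R) = ∏ j ∈ s, (Polynomial.X - Polynomial.C (x j)) := by
    rw [Polynomial.map_divByMonic _ hGmonic, hF, hG, ← Finset.prod_compl_mul_prod s]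
    exact Polynomial.mul_divByMonic_cancel_left _ (hG ▸ hGmonic.map _)
  rw [← hdiv, Polynomial.coeff_map]
  exact ((F /ₘ G).coeff k).2

end Tower

section Graded

variable {K τ : Type*}

/-- A set of polynomials is graded when it contains the homogeneous components of its members. -/
def IsGraded [CommSemiring K] (s : Set (MvPolynomial τ K)) : Prop :=
  ∀ p ∈ s, ∀ n, homogeneousComponent n p ∈ s

section Components

attribute [local instance] MvPolynomial.gradedAlgebra

theorem homogeneousComponent_mul_of_isHomogeneous [CommSemiring K] (p : MvPolynomial τ K)
    {q : MvPolynomial τ K} {m : ℕ} (hq : q.IsHomogeneous m) (n : ℕ) :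
    homogeneousComponent n (p * q) = if m ≤ n then homogeneousComponent (n - m) p * q else 0 := by
  have h := DirectSum.coe_decompose_mul_of_right_mem (homogeneousSubmodule τ K) n (a := p) hq
  simpa only [← DirectSum.Decomposition.decompose'_eq, decomposition.decompose'_apply] using h

end Components

variable [Field K]

/-- The augmentation ideal of an algebra of polynomials: its members without constant term. -/
noncomputable def posIdeal (S : Subalgebra K (MvPolynomial τ K)) : Ideal S :=
  RingHom.ker ((constantCoeff (R := K) (σ := τ)).comp S.val.toRingHom)

variable {S : Subalgebra K (MvPolynomial τ K)}

/-- The Hilbert ideal of an algebra `S` of polynomials, generated by the members of `S` without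
constant term; it is regarded as a module over `S`. -/
noncomputable abbrev hilbertIdeal (S : Subalgebra K (MvPolynomial τ K)) :
    Submodule S (MvPolynomial τ K) :=
  posIdeal S • ⊤

theorem mem_posIdeal {s : S} : s ∈ posIdeal S ↔ constantCoeff (s : MvPolynomial τ K) = 0 :=
  Iff.rfl

theorem homogeneousComponent_smul_of_isHomogeneous (hS : IsGraded (S : Set (MvPolynomial τ K)))
    (s : S) {q : MvPolynomial τ K} {m : ℕ} (hq : q.IsHomogeneous m) (n : ℕ) :
    homogeneousComponent n (s • q) =
      if m ≤ n then (⟨_, hS _ s.2 (n - m)⟩ : S) • q else 0 := by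
  rw [Subalgebra.smul_def, smul_eq_mul, homogeneousComponent_mul_of_isHomogeneous _ hq]
  rfl

theorem isGraded_span (hS : IsGraded (S : Set (MvPolynomial τ K))) {H : Set (MvPolynomial τ K)}
    (hH : ∀ p ∈ H, ∃ n, p.IsHomogeneous n) :
    IsGraded (Submodule.span S H : Set (MvPolynomial τ K)) := by
  intro p hp n
  obtain ⟨r, s, q, rfl⟩ := Submodule.mem_span_set'.1 hp
  rw [map_sum]
  refine sum_mem fun i _ => ?_
  obtain ⟨m, hm⟩ := hH _ (q i).2
  rw [homogeneousComponent_smul_of_isHomogeneous hS (s i) hm]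
  split_ifs
  · exact Submodule.smul_mem _ _ (Submodule.subset_span (q i).2)
  · exact zero_mem _

theorem homogeneousComponent_mem_posIdeal (hS : IsGraded (S : Set (MvPolynomial τ K))) {s : S}
    (hs : s ∈ posIdeal S) (n : ℕ) : (⟨_, hS _ s.2 n⟩ : S) ∈ posIdeal S := by
  rw [mem_posIdeal, constantCoeff_eq] at hs ⊢
  rw [coeff_homogeneousComponent, hs, ite_self]

theorem homogeneousComponent_mem_posIdeal_smul_span
    (hS : IsGraded (S : Set (MvPolynomial τ K))) {x : MvPolynomial τ K}
    (hx : x ∈ hilbertIdeal S) (n : ℕ) :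
    homogeneousComponent n x ∈
      posIdeal S • Submodule.span S {q : MvPolynomial τ K | ∃ m < n, q.IsHomogeneous m} := by
  refine Submodule.smul_induction_on hx (fun s hs p _ => ?_) fun x y hx hy =>
    map_add (homogeneousComponent n) x y ▸ add_mem hx hy
  rw [← sum_homogeneousComponent p, Finset.smul_sum, map_sum]
  refine sum_mem fun m _ => ?_
  have hm := homogeneousComponent_isHomogeneous m p
  rw [homogeneousComponent_smul_of_isHomogeneous hS s hm]
  rcases lt_trichotomy m n with hlt | rfl | hgt
  · rw [if_pos hlt.le]
    exact Submodule.smul_mem_smul (homogeneousComponent_mem_posIdeal hS hs (n - m))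
      (Submodule.subset_span ⟨m, hlt, hm⟩)
  · have hzero : (⟨_, hS _ s.2 (m - m)⟩ : S) = 0 := Subtype.ext <| by
      change homogeneousComponent (m - m) (s : MvPolynomial τ K) = 0
      rw [Nat.sub_self, homogeneousComponent_zero, ← constantCoeff_eq, mem_posIdeal.1 hs, C_0]
    rw [if_pos le_rfl, hzero, zero_smul]
    exact zero_mem _
  · rw [if_neg hgt.not_ge]
    exact zero_mem _

theorem isGraded_hilbertIdeal (hS : IsGraded (S : Set (MvPolynomial τ K))) :
    IsGraded (hilbertIdeal S : Set (MvPolynomial τ K)) :=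
  fun _ hx n => Submodule.smul_mono le_rfl le_top
    (homogeneousComponent_mem_posIdeal_smul_span hS hx n)

theorem eq_top_of_sup_hilbertIdeal_eq_top (hS : IsGraded (S : Set (MvPolynomial τ K)))
    {M : Submodule S (MvPolynomial τ K)} (hM : IsGraded (M : Set (MvPolynomial τ K)))
    (hsup : M ⊔ hilbertIdeal S = ⊤) : M = ⊤ := by
  have hhom : ∀ n (p : MvPolynomial τ K), p.IsHomogeneous n → p ∈ M := by
    intro n
    induction n using Nat.strong_induction_on with
    | _ n ih =>
      intro p hp
      obtain ⟨y, hy, z, hz, hyz⟩ := Submodule.mem_sup.1 (hsup ▸ Submodule.mem_top : p ∈ _)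
      rw [← homogeneousComponent_eq_self hp, ← hyz, map_add]
      have hle : Submodule.span S {q : MvPolynomial τ K | ∃ m < n, q.IsHomogeneous m} ≤ M :=
        Submodule.span_le.2 fun q ⟨m, hm, hq⟩ => ih m hm q hq
      exact add_mem (hM y hy n)
        (hle (Submodule.smul_le_right (homogeneousComponent_mem_posIdeal_smul_span hS hz n)))
  refine eq_top_iff.2 fun p _ => ?_
  rw [← sum_homogeneousComponent p]
  exact sum_mem fun n _ => hhom n _ (homogeneousComponent_isHomogeneous n p)

theorem smul_sub_smul_mem_hilbertIdeal (s : S) (p : MvPolynomial τ K) :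
    s • p - constantCoeff (s : MvPolynomial τ K) • p ∈ hilbertIdeal S := by
  have hs : s - algebraMap K S (constantCoeff (s : MvPolynomial τ K)) ∈ posIdeal S := by
    rw [mem_posIdeal]
    change constantCoeff ((s : MvPolynomial τ K) - C (constantCoeff (s : MvPolynomial τ K))) = 0
    simp
  have h := Submodule.smul_mem_smul hs (Submodule.mem_top (x := p))
  rwa [sub_smul, algebraMap_smul] at h

theorem restrictScalars_span_le_span_sup (H : Set (MvPolynomial τ K)) :
    (Submodule.span S H).restrictScalars K ≤
      Submodule.span K H ⊔ (hilbertIdeal S).restrictScalars K := by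
  intro p hp
  obtain ⟨r, s, q, rfl⟩ := Submodule.mem_span_set'.1 hp
  refine sum_mem fun i _ => ?_
  rw [← add_sub_cancel (constantCoeff (s i : MvPolynomial τ K) • (q i : MvPolynomial τ K))
    (s i • _)]
  exact Submodule.add_mem_sup (Submodule.smul_mem _ _ (Submodule.subset_span (q i).2))
    (smul_sub_smul_mem_hilbertIdeal _ _)

theorem mem_span_isHomogeneous_sup (hS : IsGraded (S : Set (MvPolynomial τ K)))
    {H : Set (MvPolynomial τ K)} (hH : ∀ p ∈ H, ∃ n, p.IsHomogeneous n)
    (hHtop : Submodule.span S H = ⊤) {p : MvPolynomial τ K} {n : ℕ} (hp : p.IsHomogeneous n) :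
    p ∈ Submodule.span K {q | q ∈ H ∧ q.IsHomogeneous n} ⊔ (hilbertIdeal S).restrictScalars K := by
  have hsup := restrictScalars_span_le_span_sup H (hHtop.ge Submodule.mem_top : p ∈ _)
  obtain ⟨y, hy, z, hz, rfl⟩ := Submodule.mem_sup.1 hsup
  rw [← homogeneousComponent_eq_self hp, map_add]
  refine Submodule.add_mem_sup ?_ (isGraded_hilbertIdeal hS z hz n)
  have hle : Submodule.span K H ≤
      (Submodule.span K {q | q ∈ H ∧ q.IsHomogeneous n}).comap (homogeneousComponent n) :=
    Submodule.span_le.2 fun q hq => by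
      obtain ⟨m, hm⟩ := hH q hq
      rw [SetLike.mem_coe, Submodule.mem_comap, homogeneousComponent_of_mem hm]
      split_ifs with h
      · exact Submodule.subset_span ⟨hq, h ▸ hm⟩
      · exact zero_mem _
  exact hle hy

theorem adjoin_range_X_eq_top (S : Subalgebra K (MvPolynomial τ K)) :
    Algebra.adjoin S (Set.range (X : τ → MvPolynomial τ K)) = ⊤ := by
  have hle : Algebra.adjoin K (Set.range X) ≤
      (Algebra.adjoin S (Set.range (X : τ → MvPolynomial τ K))).restrictScalars K :=
    Algebra.adjoin_le Algebra.subset_adjoin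
  rw [adjoin_range_X] at hle
  exact eq_top_iff.2 fun p _ => hle Algebra.mem_top

theorem exists_fin_span_eq_top (hS : IsGraded (S : Set (MvPolynomial τ K)))
    {H : Set (MvPolynomial τ K)} (hH : ∀ p ∈ H, ∃ n, p.IsHomogeneous n)
    (hHtop : Submodule.span K H = ⊤) {ι : Type*} [Fintype ι] {h : ι → MvPolynomial τ K}
    (hh : Submodule.span S (Set.range h) = ⊤) :
    ∃ r ≤ Fintype.card ι, ∃ b : Fin r → MvPolynomial τ K,
      (∀ i, b i ∈ H) ∧ Submodule.span S (Set.range b) = ⊤ := by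
  let P := (hilbertIdeal S).restrictScalars K
  have hquot : Submodule.span K (Set.range (P.mkQ ∘ h)) = ⊤ := by
    have hsup := restrictScalars_span_le_span_sup (S := S) (Set.range h)
    rw [hh, Submodule.restrictScalars_top, top_le_iff, sup_comm] at hsup
    rw [Set.range_comp, ← Submodule.map_span, Submodule.map_mkQ_eq_top, hsup]
  have hHquot : Submodule.span K (P.mkQ '' H) = ⊤ := by
    rw [← Submodule.map_span, hHtop, Submodule.map_top, Submodule.range_mkQ]
  have : Module.Finite K (MvPolynomial τ K ⧸ P) :=
    ⟨hquot ▸ Submodule.fg_span (Set.finite_range _)⟩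
  obtain ⟨f, hf, hfspan, -⟩ := Submodule.exists_fun_fin_finrank_span_eq K (P.mkQ '' H)
  choose b hbH hb using hf
  refine ⟨_, ?_, b, hbH, eq_top_of_sup_hilbertIdeal_eq_top hS (isGraded_span hS ?_) ?_⟩
  · rw [hHquot, ← hquot]
    exact finrank_range_le_card (P.mkQ ∘ h)
  · rintro _ ⟨i, rfl⟩
    exact hH _ (hbH i)
  · have hsup : P ⊔ Submodule.span K (Set.range b) = ⊤ := by
      rw [← Submodule.map_mkQ_eq_top, Submodule.map_span, ← Set.range_comp,
        (funext hb : P.mkQ ∘ b = f), hfspan, hHquot]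
    refine eq_top_iff.2 fun p _ => ?_
    obtain ⟨y, hy, z, hz, rfl⟩ := Submodule.mem_sup.1 (hsup ▸ Submodule.mem_top : p ∈ _)
    exact add_comm y z ▸ Submodule.add_mem_sup (Submodule.span_le_restrictScalars K S _ hz) hy

theorem isHomogeneous_repr (hS : IsGraded (S : Set (MvPolynomial τ K)))
    {A : Submodule S (MvPolynomial τ K)} {ι : Type*} (Ψ : Module.Basis ι S A) {n : ι → ℕ}
    (hn : ∀ i, (Ψ i : MvPolynomial τ K).IsHomogeneous (n i)) {m : ℕ} {x : A}
    (hx : (x : MvPolynomial τ K).IsHomogeneous m) {i : ι} (hi : Ψ.repr x i ≠ 0) :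
    n i ≤ m ∧ (Ψ.repr x i : MvPolynomial τ K).IsHomogeneous (m - n i) := by
  let s : ι → S := fun j => if n j ≤ m then ⟨_, hS _ (Ψ.repr x j).2 (m - n j)⟩ else 0
  have hs : ∀ j, homogeneousComponent m (Ψ.repr x j • (Ψ j : MvPolynomial τ K)) =
      s j • (Ψ j : MvPolynomial τ K) := fun j => by
    rw [homogeneousComponent_smul_of_isHomogeneous hS _ (hn j), ← zero_smul S, ← ite_smul]
  have hrepr : Ψ.repr x i = s i := by
    refine repr_eq_of_coe_eq_sum Ψ ?_ (Finsupp.mem_support_iff.2 hi)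
    rw [← Finset.sum_congr rfl fun j _ => hs j, ← map_sum, ← coe_eq_sum_repr,
      homogeneousComponent_eq_self hx]
  rw [hrepr] at hi ⊢
  simp only [s] at hi ⊢
  split_ifs with hle
  · exact ⟨hle, homogeneousComponent_isHomogeneous _ _⟩
  · exact absurd (if_neg hle) hi

theorem eq_and_isUnit_repr_of_notMem_posIdeal (hS : IsGraded (S : Set (MvPolynomial τ K)))
    {A : Submodule S (MvPolynomial τ K)} {ι : Type*} (Ψ : Module.Basis ι S A) {n : ι → ℕ}
    (hn : ∀ i, (Ψ i : MvPolynomial τ K).IsHomogeneous (n i)) {m : ℕ} {x : A}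
    (hx : (x : MvPolynomial τ K).IsHomogeneous m) {i : ι} (hi : Ψ.repr x i ∉ posIdeal S) :
    n i = m ∧ IsUnit (Ψ.repr x i) := by
  obtain ⟨hle, hhom⟩ := isHomogeneous_repr hS Ψ hn hx (ne_of_mem_of_not_mem (zero_mem _) hi).symm
  rw [mem_posIdeal, constantCoeff_eq] at hi
  have hdeg : 0 = m - n i := by simpa using hhom hi
  refine ⟨hle.antisymm (Nat.sub_eq_zero_iff_le.1 hdeg.symm), ?_⟩
  have hC : Ψ.repr x i = algebraMap K S (coeff 0 (Ψ.repr x i : MvPolynomial τ K)) :=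
    Subtype.ext (totalDegree_eq_zero_iff_eq_C.1
      (Nat.le_zero.1 (hdeg ▸ hhom.totalDegree_le)))
  rw [hC]
  exact (IsUnit.mk0 _ hi).map _

end Graded

section GradedBasis

variable {K τ : Type*} [Field K] {S : Subalgebra K (MvPolynomial τ K)}
  {A : Submodule S (MvPolynomial τ K)} {e : MvPolynomial τ K →ₗ[S] MvPolynomial τ K} {ι : Type*}

theorem span_isHomogeneous_mem_or_eq_zero_eq_top (he : LinearMap.IsProj A e)
    (hhom : ∀ p n, p.IsHomogeneous n → (e p).IsHomogeneous n) :
    Submodule.span K {p | (∃ n, p.IsHomogeneous n) ∧ (p ∈ A ∨ e p = 0)} = ⊤ := by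
  refine eq_top_iff.2 fun p _ => ?_
  rw [← sum_homogeneousComponent p]
  refine sum_mem fun n _ => ?_
  have hn := homogeneousComponent_isHomogeneous n p
  rw [← add_sub_cancel (e (homogeneousComponent n p)) (homogeneousComponent n p)]
  refine add_mem (Submodule.subset_span ⟨⟨n, hhom _ n hn⟩, .inl (he.map_mem _)⟩)
    (Submodule.subset_span ⟨⟨n, hn.sub (hhom _ n hn)⟩, .inr ?_⟩)
  rw [map_sub, he.map_id _ (he.map_mem _), sub_self]

theorem exists_basis_isHomogeneous_of_isProj (hS : IsGraded (S : Set (MvPolynomial τ K)))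
    (he : LinearMap.IsProj A e) (hhom : ∀ p n, p.IsHomogeneous n → (e p).IsHomogeneous n)
    {G : Type*} [Fintype G] {φ : G → MvPolynomial τ K →ₐ[S] MvPolynomial τ K}
    (hφ : Function.Injective φ) [Fintype ι] {h : ι → MvPolynomial τ K}
    (hh : Submodule.span S (Set.range h) = ⊤) (hcard : Fintype.card ι ≤ Fintype.card G) :
    ∃ (r : ℕ) (Ψ : Module.Basis (Fin r) S A),
      ∀ i, ∃ n, (Ψ i : MvPolynomial τ K).IsHomogeneous n := by
  obtain ⟨r, hr, b, hbH, hb⟩ := exists_fin_span_eq_top hS (fun p hp => hp.1)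
    (span_isHomogeneous_mem_or_eq_zero_eq_top he hhom) hh
  have hli : LinearIndependent S b := linearIndependent_of_span_eq_top hφ hb
    ((Fintype.card_fin r).trans_le (hr.trans hcard))
  let B := Module.Basis.mk hli hb.ge
  have hB : ∀ i, B i = b i := Module.Basis.mk_apply hli hb.ge
  obtain ⟨m, Ψ, hΨ⟩ := exists_basis_of_isProj he B fun i => hB i ▸ (hbH i).2
  refine ⟨m, Ψ, fun i => ?_⟩
  obtain ⟨j, hj⟩ := hΨ i
  rw [← hj, hB]
  exact (hbH j).1

theorem notMem_posIdeal_of_isUnit {s : S} (hs : IsUnit s) : s ∉ posIdeal S := fun h =>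
  RingHom.ker_ne_top _ (Ideal.eq_top_of_isUnit_mem _ h hs)

theorem basis_notMem_hilbertIdeal (he : LinearMap.IsProj A e) (Ψ : Module.Basis ι S A) (i : ι) :
    (Ψ i : MvPolynomial τ K) ∉ hilbertIdeal S := fun h =>
  notMem_posIdeal_of_isUnit isUnit_one <| by
    simpa using (forall_repr_mem_iff_of_isProj he Ψ).2 h i

theorem exists_isUnit_repr_of_notMem_hilbertIdeal (hS : IsGraded (S : Set (MvPolynomial τ K)))
    (he : LinearMap.IsProj A e) (Ψ : Module.Basis ι S A) {n : ι → ℕ}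
    (hn : ∀ i, (Ψ i : MvPolynomial τ K).IsHomogeneous (n i)) {x : A} {m : ℕ}
    (hx : (x : MvPolynomial τ K).IsHomogeneous m)
    (hxS : (x : MvPolynomial τ K) ∉ hilbertIdeal S) :
    ∃ i, n i = m ∧ IsUnit (Ψ.repr x i) := by
  obtain ⟨i, hi⟩ := not_forall.1 ((forall_repr_mem_iff_of_isProj he Ψ).not.2 hxS)
  exact ⟨i, eq_and_isUnit_repr_of_notMem_posIdeal hS Ψ hn hx hi⟩

theorem ne_zero_of_basis_sub_C_mul_mem (he : LinearMap.IsProj A e) (Ψ : Module.Basis ι S A)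
    {i : ι} {p : MvPolynomial τ K} {c : K}
    (hc : (Ψ i : MvPolynomial τ K) - C c * p ∈ hilbertIdeal S) : c ≠ 0 := by
  rintro rfl
  rw [C_0, zero_mul, sub_zero] at hc
  exact basis_notMem_hilbertIdeal he Ψ i hc

theorem eq_of_basis_sub_C_mul_mem (he : LinearMap.IsProj A e) (Ψ : Module.Basis ι S A) {i j : ι}
    {x : A} (hi : IsUnit (Ψ.repr x i)) {c : K}
    (hc : (Ψ j : MvPolynomial τ K) - C c * (x : MvPolynomial τ K) ∈ hilbertIdeal S) : j = i := by
  by_contra hne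
  have hmem : algebraMap K S c * Ψ.repr x i ∈ posIdeal S :=
    mul_repr_mem_of_basis_sub_smul_mem he Ψ hne hc
  have hunit : IsUnit (algebraMap K S c) :=
    (IsUnit.mk0 c (ne_zero_of_basis_sub_C_mul_mem he Ψ hc)).map _
  exact notMem_posIdeal_of_isUnit (hunit.mul hi) hmem

theorem sub_C_mul_mem_posIdeal_smul (he : LinearMap.IsProj A e) {x y : A} {c : K}
    (h : (x : MvPolynomial τ K) - C c * (y : MvPolynomial τ K) ∈ hilbertIdeal S) :
    (x : MvPolynomial τ K) - C c * (y : MvPolynomial τ K) ∈ posIdeal S • A := by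
  rw [smul_eq_smul_top_inf_of_isProj he]
  exact ⟨h, sub_mem x.2 (A.smul_mem (algebraMap K S c) y.2)⟩

theorem exists_basis_isHomogeneous_replace (Ψ : Module.Basis ι S A)
    (hΨ : ∀ i, ∃ n, (Ψ i : MvPolynomial τ K).IsHomogeneous n) {i : ι} {x : A}
    (hx : ∃ n, (x : MvPolynomial τ K).IsHomogeneous n) (hi : IsUnit (Ψ.repr x i)) :
    ∃ Ψ' : Module.Basis ι S A, (∀ j, ∃ n, (Ψ' j : MvPolynomial τ K).IsHomogeneous n) ∧
      Ψ' i = x ∧ ∀ j, j ≠ i → Ψ' j = Ψ j := by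
  obtain ⟨Ψ', hi', hΨ'⟩ := @exists_basis_replace S A ι _ _ A.module Ψ i x hi
  refine ⟨Ψ', fun j => ?_, hi', hΨ'⟩
  rcases eq_or_ne j i with rfl | hj
  · exact hi' ▸ hx
  · exact hΨ' j hj ▸ hΨ j

end GradedBasis

section SignTwist

variable {K S G V : Type*} [CommRing S] [Group G] [AddCommGroup V] [Module S V]

/-- The twist of a representation by a character with values in `{1, -1}`; its invariants are the
relative invariants for that character. -/
def signTwist (ρ : Representation S G V) (χ : G →* ℤˣ) : Representation S G V where
  toFun g := χ g • ρ g
  map_one' := by rw [map_one, map_one, one_smul]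
  map_mul' g h := by rw [map_mul, map_mul, smul_mul_smul_comm]

theorem signTwist_apply (ρ : Representation S G V) (χ : G →* ℤˣ) (g : G) (v : V) :
    signTwist ρ χ g v = χ g • ρ g v :=
  rfl

theorem mem_invariants_signTwist {ρ : Representation S G V} {χ : G →* ℤˣ} {v : V} :
    v ∈ (signTwist ρ χ).invariants ↔ ∀ g, ρ g v = χ g • v :=
  forall_congr' fun g => by
    rw [signTwist_apply, smul_eq_iff_eq_inv_smul, Int.units_inv_eq_self]

theorem exists_isProj_invariants [Field K] [Algebra K S] [Module K V] [IsScalarTower K S V]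
    [Fintype G] (hG : (Fintype.card G : K) ≠ 0) (ρ : Representation S G V) :
    ∃ e : V →ₗ[S] V, LinearMap.IsProj ρ.invariants e ∧
      ∀ W : Submodule K V, (∀ g, ∀ v ∈ W, ρ g v ∈ W) → ∀ v ∈ W, e v ∈ W := by
  let : Invertible (Fintype.card G : K) := invertibleOfNonzero hG
  let : Invertible (Fintype.card G : S) :=
    (Invertible.map (algebraMap K S) (Fintype.card G : K)).copy _ (map_natCast _ _).symm
  refine ⟨ρ.averageMap, ρ.isProj_averageMap, fun W hW v hv => ?_⟩
  have havg : ρ.averageMap v = (⅟(Fintype.card G : K)) • ∑ g, ρ g v := by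
    rw [Representation.averageMap, GroupAlgebra.average, map_smul, map_sum, LinearMap.smul_apply,
      LinearMap.sum_apply, ← algebraMap_smul S (⅟(Fintype.card G : K))]
    simp only [MonoidAlgebra.of_apply, Representation.asAlgebraHom_single_one]
    rfl
  rw [havg]
  exact W.smul_mem _ (sum_mem fun g _ => hW g v hv)

end SignTwist

section CoordPerm

variable {K : Type*} [Field K] {d N : ℕ}

/-- The group of all separate permutations of the coordinates in each direction, acting on the
variables. -/
def coordPerm : (Fin d → Equiv.Perm (Fin N)) →* Equiv.Perm (Fin d × Fin N) where
  toFun := Equiv.prodCongrRight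
  map_one' := rfl
  map_mul' _ _ := rfl

theorem coordPerm_apply (g : Fin d → Equiv.Perm (Fin N)) (x : Fin d × Fin N) :
    coordPerm g x = (x.1, g x.1 x.2) :=
  rfl

theorem coordPerm_mulSingle (a : Fin d) (σ : Equiv.Perm (Fin N)) :
    ⇑(coordPerm (Pi.mulSingle a σ)) = permCoord a σ := by
  funext ⟨b, k⟩
  rw [coordPerm_apply, permCoord]
  rcases eq_or_ne b a with rfl | hb
  · simp
  · simp [hb]

theorem coordPerm_injective :
    Function.Injective (coordPerm : (Fin d → Equiv.Perm (Fin N)) → _) := fun g h hgh => by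
  ext a i : 2
  exact congrArg Prod.snd (DFunLike.congr_fun hgh (a, i))

theorem rename_coordPerm_of_mem {p : Wave K d N} (hp : p ∈ sepSymm K d N)
    (g : Fin d → Equiv.Perm (Fin N)) : rename (coordPerm g) p = p := by
  let H : Submonoid (Fin d → Equiv.Perm (Fin N)) :=
    { carrier := {g | rename (coordPerm g) p = p}
      one_mem' := by rw [Set.mem_ofPred_eq, map_one, Equiv.Perm.coe_one, rename_id_apply]
      mul_mem' := fun {g h} (hg : rename _ p = p) (hh : rename _ p = p) => by
        rw [Set.mem_ofPred_eq, map_mul, Equiv.Perm.coe_mul, ← rename_rename, hh, hg] }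
  refine Submonoid.pi_mem_of_mulSingle_mem (H := H) g fun a => ?_
  change rename (coordPerm (Pi.mulSingle a (g a))) p = p
  rw [coordPerm_mulSingle]
  exact hp a (g a)

theorem isGraded_sepSymm : IsGraded (sepSymm K d N : Set (Wave K d N)) := fun p hp n a σ => by
  rw [rename_homogeneousComponent, hp a σ]

/-- The action of the separate coordinate permutations on the polynomials. -/
noncomputable def coordPermAlgHom (K : Type*) [Field K] (d N : ℕ) :
    (Fin d → Equiv.Perm (Fin N)) →* (Wave K d N →ₐ[sepSymm K d N] Wave K d N) where
  toFun g :=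
    { (rename (coordPerm g) : Wave K d N →ₐ[K] Wave K d N) with
      commutes' := fun s => rename_coordPerm_of_mem s.2 g }
  map_one' := AlgHom.ext rename_id_apply
  map_mul' g h := AlgHom.ext fun p => (rename_rename (coordPerm h) (coordPerm g) p).symm

theorem coordPermAlgHom_injective : Function.Injective (coordPermAlgHom K d N) := fun g h hgh =>
  coordPerm_injective (Equiv.ext fun x => X_injective (R := K) (by
    simpa [coordPermAlgHom] using DFunLike.congr_fun hgh (X x)))

/-- The action of the coordinate permutations twisted by the sign; its invariants are the
polynomials that are alternating in each direction separately. -/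
noncomputable def alternatingRep (K : Type*) [Field K] (d N : ℕ) :
    Representation (sepSymm K d N) (Fin d → Equiv.Perm (Fin N)) (Wave K d N) :=
  signTwist (AlgHom.toEnd.comp (coordPermAlgHom K d N)) (Equiv.Perm.sign.comp coordPerm)

/-- The action of the particle permutations twisted by the sign; its invariants are the
diagonally antisymmetric polynomials. -/
noncomputable def antisymmRep (K : Type*) [Field K] (d N : ℕ) :
    Representation (sepSymm K d N) (Equiv.Perm (Fin N)) (Wave K d N) :=
  signTwist ((AlgHom.toEnd.comp (coordPermAlgHom K d N)).comp (Pi.constMonoidHom _ _))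
    Equiv.Perm.sign

theorem mem_invariants_alternatingRep {p : Wave K d N} :
    p ∈ (alternatingRep K d N).invariants ↔
      ∀ g, rename (coordPerm g) p = Equiv.Perm.sign (coordPerm g) • p :=
  mem_invariants_signTwist

theorem invariants_antisymmRep : (antisymmRep K d N).invariants = antisymm K d N := by
  ext p
  refine mem_invariants_signTwist.trans (forall_congr' fun σ => ?_)
  rw [map_intCast, Units.smul_def, zsmul_eq_mul]
  rfl

theorem exists_isProj_antisymm (hN : (N.factorial : K) ≠ 0) :
    ∃ e : Wave K d N →ₗ[sepSymm K d N] Wave K d N, LinearMap.IsProj (antisymm K d N) e ∧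
      ∀ p n, p.IsHomogeneous n → (e p).IsHomogeneous n := by
  obtain ⟨e, he, heW⟩ := exists_isProj_invariants (K := K)
    (by rwa [Fintype.card_perm, Fintype.card_fin]) (antisymmRep K d N)
  refine ⟨e, invariants_antisymmRep (K := K) ▸ he, fun p n hp =>
    heW (homogeneousSubmodule _ K n) (fun σ q hq => ?_) p hp⟩
  rw [antisymmRep, signTwist_apply, Units.smul_def]
  exact zsmul_mem (IsHomogeneous.rename_isHomogeneous hq) _

end CoordPerm

section Vandermonde

variable {K : Type*} [Field K] {d N : ℕ}

theorem sum_range_card_le_sum_of_injective {ι : Type*} [Fintype ι] {f : ι → ℕ}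
    (hf : Function.Injective f) : ∑ k ∈ Finset.range (Fintype.card ι), k ≤ ∑ i, f i := by
  have hinj : Function.Injective fun i => (f i : ℤ) := Nat.cast_injective.comp hf
  have h := Finset.sum_range_le_sum (s := Finset.univ.map ⟨_, hinj⟩) (c := 0) (by simp)
  rw [Finset.sum_map, Finset.card_map, Finset.card_univ] at h
  rw [← Nat.cast_le (α := ℤ), Nat.cast_sum, Nat.cast_sum]
  simpa using h

theorem coeff_eq_zero_of_rename_swap_eq_neg {τ : Type*} [DecidableEq τ] (h2 : (2 : K) ≠ 0)
    {p : MvPolynomial τ K} {x y : τ} (hp : rename (Equiv.swap x y) p = -p) {m : τ →₀ ℕ}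
    (hm : m x = m y) : coeff m p = 0 := by
  have hmap : m.mapDomain (Equiv.swap x y) = m := by
    ext z
    rw [Finsupp.mapDomain_equiv_apply, Equiv.symm_swap, Equiv.swap_apply_def]
    split_ifs <;> simp_all
  have h := congrArg (coeff m) hp
  rw [coeff_neg, ← hmap, coeff_rename_mapDomain _ (Equiv.injective _), hmap] at h
  have htwo : 2 * coeff m p = 0 := by linear_combination h
  exact (mul_eq_zero.1 htwo).resolve_left h2

theorem isHomogeneous_det_vandermonde {τ : Type*} {x : Fin N → MvPolynomial τ K}
    (hx : ∀ i, (x i).IsHomogeneous 1) :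
    (Matrix.vandermonde x).det.IsHomogeneous (∑ i : Fin N, (i : ℕ)) := by
  rw [Matrix.det_apply]
  refine IsHomogeneous.sum _ _ _ fun σ _ => ?_
  refine zsmul_mem ((mem_homogeneousSubmodule _ _).2 (IsHomogeneous.prod _ _ _ fun i _ => ?_)) _
  simpa using (hx (σ i)).pow (i : ℕ)

/-- The degree of `vandermondeProd K d N`, computed on its monomial `∏ x, X x ^ x.2`. -/
def topGrade (d N : ℕ) : ℕ :=
  ∑ x : Fin d × Fin N, (x.2 : ℕ)

theorem topGrade_eq_sum_sum (d N : ℕ) : topGrade d N = ∑ _a : Fin d, ∑ i : Fin N, (i : ℕ) :=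
  Fintype.sum_prod_type _

theorem topGrade_eq (d N : ℕ) : topGrade d N = d * N * (N - 1) / 2 := by
  rw [topGrade_eq_sum_sum, Fin.sum_univ_eq_sum_range (fun i => i), Finset.sum_range_id,
    Finset.sum_const, Finset.card_univ, Fintype.card_fin, smul_eq_mul, mul_assoc,
    Nat.mul_div_assoc _ (Nat.even_mul_pred_self N).two_dvd]

theorem coordPerm_mulSingle_swap (a : Fin d) (i j : Fin N) :
    coordPerm (Pi.mulSingle a (Equiv.swap i j)) = Equiv.swap (a, i) (a, j) := by
  ext1 ⟨b, k⟩
  rw [coordPerm_mulSingle, permCoord, Equiv.swap_apply_def, Equiv.swap_apply_def]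
  split_ifs <;> simp_all

theorem two_ne_zero_of_factorial_ne_zero (hN : (N.factorial : K) ≠ 0) {i j : Fin N}
    (hij : i ≠ j) : (2 : K) ≠ 0 := fun h2 => by
  obtain ⟨c, hc⟩ := Nat.dvd_factorial two_pos
    (show 2 ≤ N from Fin.nontrivial_iff_two_le.1 ⟨i, j, hij⟩)
  rw [hc, Nat.cast_mul, Nat.cast_two, h2, zero_mul] at hN
  exact hN rfl

theorem mem_pow_idealOfVars_of_mem_invariants (hN : (N.factorial : K) ≠ 0) {p : Wave K d N}
    (hp : p ∈ (alternatingRep K d N).invariants) :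
    p ∈ idealOfVars (Fin d × Fin N) K ^ topGrade d N := by
  rw [mem_pow_idealOfVars_iff]
  intro m hm
  have hinj : ∀ a, Function.Injective fun i => m (a, i) := fun a i j hij => by
    by_contra hne
    refine mem_support_iff.1 hm (coeff_eq_zero_of_rename_swap_eq_neg
      (two_ne_zero_of_factorial_ne_zero hN hne) (x := (a, i)) (y := (a, j)) ?_ hij)
    rw [← coordPerm_mulSingle_swap, mem_invariants_alternatingRep.1 hp, coordPerm_mulSingle_swap,
      Equiv.Perm.sign_swap (by simpa using hne), Units.neg_smul, one_smul]
  rw [Finsupp.degree_eq_sum, Fintype.sum_prod_type, topGrade_eq_sum_sum]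
  refine Finset.sum_le_sum fun a _ => ?_
  simpa [Fin.sum_univ_eq_sum_range (fun i => i)] using sum_range_card_le_sum_of_injective (hinj a)

theorem vandermondeProd_mem_invariants :
    vandermondeProd K d N ∈ (alternatingRep K d N).invariants := by
  refine mem_invariants_alternatingRep.2 fun g => ?_
  have hdet : ∀ a, rename (coordPerm g)
      (Matrix.vandermonde fun i : Fin N => (X (a, i) : Wave K d N)).det =
      (Equiv.Perm.sign (g a) : ℤ) *
        (Matrix.vandermonde fun i : Fin N => (X (a, i) : Wave K d N)).det := fun a => by
    rw [← Matrix.det_permute, AlgHom.map_det]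
    congr 1
    ext i j : 2
    simp [Matrix.vandermonde_apply, coordPerm_apply]
  rw [vandermondeProd, map_prod, Finset.prod_congr rfl fun a _ => hdet a, Finset.prod_mul_distrib,
    ← Int.cast_prod, ← Units.coe_prod, Units.smul_def, zsmul_eq_mul]
  congr 3
  exact (Equiv.Perm.sign_prodCongrRight g).symm

theorem vandermondeProd_mem_antisymm (hd : Odd d) : vandermondeProd K d N ∈ antisymm K d N := by
  rw [← invariants_antisymmRep]
  refine mem_invariants_signTwist.2 fun σ => ?_
  refine (mem_invariants_alternatingRep.1 vandermondeProd_mem_invariants fun _ => σ).trans ?_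
  congr 1
  refine (Equiv.Perm.sign_prodCongrRight fun _ : Fin d => σ).trans ?_
  rw [Finset.prod_const, Finset.card_univ, Fintype.card_fin, Int.units_pow_eq_pow_mod_two,
    Nat.odd_iff.1 hd, pow_one]

theorem isHomogeneous_vandermondeProd : (vandermondeProd K d N).IsHomogeneous (topGrade d N) := by
  rw [topGrade_eq_sum_sum]
  exact IsHomogeneous.prod Finset.univ _ _ fun a _ =>
    isHomogeneous_det_vandermonde fun i => isHomogeneous_X K (a, i)

theorem vandermondeProd_ne_zero : vandermondeProd K d N ≠ 0 :=
  Finset.prod_ne_zero_iff.2 fun _ _ => Matrix.det_vandermonde_ne_zero_iff.2 fun i j h => by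
    simpa using X_injective h

theorem mem_idealOfVars_of_mem_posIdeal {τ : Type*} {S : Subalgebra K (MvPolynomial τ K)} {s : S}
    (hs : s ∈ posIdeal S) : (s : MvPolynomial τ K) ∈ idealOfVars τ K := by
  rw [← pow_one (idealOfVars τ K), mem_pow_idealOfVars_iff]
  intro m hm
  rw [Nat.one_le_iff_ne_zero, Ne, Finsupp.degree_eq_zero_iff]
  rintro rfl
  exact mem_support_iff.1 hm hs

theorem vandermondeProd_notMem_hilbertIdeal (hN : (N.factorial : K) ≠ 0) :
    vandermondeProd K d N ∉ hilbertIdeal (sepSymm K d N) := by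
  intro hmem
  have hG : (Fintype.card (Fin d → Equiv.Perm (Fin N)) : K) ≠ 0 := by
    simpa [Fintype.card_perm] using fun h => absurd h hN
  obtain ⟨e, he, -⟩ := exists_isProj_invariants hG (alternatingRep K d N)
  have hinv := (smul_eq_smul_top_inf_of_isProj he _).ge ⟨hmem, vandermondeProd_mem_invariants⟩
  have hpow : vandermondeProd K d N ∈ idealOfVars (Fin d × Fin N) K ^ (topGrade d N + 1) := by
    refine Submodule.smul_induction_on hinv (fun s hs p hp => ?_) fun _ _ => add_mem
    rw [pow_succ', Subalgebra.smul_def, smul_eq_mul]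
    exact Ideal.mul_mem_mul (mem_idealOfVars_of_mem_posIdeal hs)
      (mem_pow_idealOfVars_of_mem_invariants hN hp)
  obtain ⟨m, hm⟩ := ne_zero_iff.1 (vandermondeProd_ne_zero (K := K) (d := d) (N := N))
  have hlt := (mem_pow_idealOfVars_iff _ _).1 hpow m (mem_support_iff.2 hm)
  exact hm (isHomogeneous_vandermondeProd.coeff_eq_zero (Nat.succ_le_iff.1 hlt).ne')

end Vandermonde

section Staircase

variable {K : Type*} [Field K] {d N : ℕ}

theorem coeff_prod_X_sub_C_mem_sepSymm (a : Fin d) (k : ℕ) :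
    (∏ j : Fin N, (Polynomial.X - Polynomial.C (X (a, j) : Wave K d N))).coeff k ∈
      sepSymm K d N := fun b σ => by
  let f : Wave K d N →+* Wave K d N := rename (R := K) (permCoord b σ)
  have hmap : (∏ j : Fin N, (Polynomial.X - Polynomial.C (X (a, j) : Wave K d N))).map f =
      ∏ j : Fin N, (Polynomial.X - Polynomial.C (X (a, j))) := by
    rw [Polynomial.map_prod]
    refine Fintype.prod_equiv (if a = b then σ else 1) _ _ fun j => ?_
    split_ifs with hab <;> simp [f, permCoord, hab]
  conv_rhs => rw [← hmap, Polynomial.coeff_map]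
  rfl

/-- The staircase monomials, in which the exponent of `X (a, i)` is at most `i`; they form a basis
of the polynomials over `sepSymm K d N`. -/
noncomputable def stairMonomial (K : Type*) [Field K] {d N : ℕ}
    (e : (x : Fin d × Fin N) → Fin (x.2 + 1)) : Wave K d N :=
  ∏ x, X x ^ (e x : ℕ)

/- The variable `X (a, i)` is a root of `∏ j ≤ i, (T - X (a, j))`. This has degree `i + 1`, and its
coefficients are polynomials in the `X (a, j)` with `j > i` over the symmetric polynomials. -/
theorem span_range_stairMonomial :
    Submodule.span (sepSymm K d N) (Set.range (stairMonomial K (d := d) (N := N))) = ⊤ := by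
  refine span_range_prod_pow_eq_top (S := sepSymm K d N) (x := X) (adjoin_range_X_eq_top _)
    (f := fun x => ∏ j ∈ Finset.Iic x.2, (Polynomial.X - Polynomial.C (X (x.1, j))))
    (n := fun x => x.2 + 1) (fun x => OrderDual.toDual x.2)
    (fun x => Polynomial.monic_prod_of_monic _ _ fun j _ => Polynomial.monic_X_sub_C _)
    (fun x => ?_) (fun x => ?_) fun x => ?_
  · rw [Polynomial.natDegree_prod_of_monic _ _ fun j _ => Polynomial.monic_X_sub_C _]
    simp
  · rw [Polynomial.IsRoot, Polynomial.eval_prod]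
    exact Finset.prod_eq_zero (Finset.mem_Iic.2 le_rfl) (by simp)
  · have hsymm : ∀ k, (∏ j, (Polynomial.X - Polynomial.C (X (x.1, j) : Wave K d N))).coeff k ∈
        Algebra.adjoin (sepSymm K d N) (X '' {u | u.2 > x.2}) := fun k =>
      Subalgebra.algebraMap_mem _ (⟨_, coeff_prod_X_sub_C_mem_sepSymm x.1 k⟩ : sepSymm K d N)
    refine coeff_prod_X_sub_C_mem _ hsymm _ fun j hj =>
      Algebra.subset_adjoin ⟨(x.1, j), ?_, rfl⟩
    simpa using hj

theorem card_stairs :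
    Fintype.card ((x : Fin d × Fin N) → Fin (x.2 + 1)) =
      Fintype.card (Fin d → Equiv.Perm (Fin N)) := by
  simp only [Fintype.card_pi, Fintype.card_fin, Fintype.prod_prod_type, Fintype.card_perm]
  refine Finset.prod_congr rfl fun _ _ => ?_
  rw [Fin.prod_univ_eq_prod_range (fun i => i + 1), Finset.prod_range_add_one_eq_factorial]

theorem isHomogeneous_stairMonomial (e : (x : Fin d × Fin N) → Fin (x.2 + 1)) :
    (stairMonomial K e).IsHomogeneous (∑ x, (e x : ℕ)) :=
  IsHomogeneous.prod _ _ _ fun _ _ => isHomogeneous_X_pow _ _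

theorem sum_eq_of_isHomogeneous_stairMonomial {e : (x : Fin d × Fin N) → Fin (x.2 + 1)} {n : ℕ}
    (h : (stairMonomial K e).IsHomogeneous n) : ∑ x, (e x : ℕ) = n :=
  (isHomogeneous_stairMonomial e).inj_right h
    (Finset.prod_ne_zero_iff.2 fun _ _ => pow_ne_zero _ (X_ne_zero _))

theorem mem_hilbertIdeal_of_topGrade_lt {p : Wave K d N} {n : ℕ} (hp : p.IsHomogeneous n)
    (hn : topGrade d N < n) : p ∈ hilbertIdeal (sepSymm K d N) := by
  have hmem := mem_span_isHomogeneous_sup isGraded_sepSymm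
    (Set.forall_mem_range.2 fun e => ⟨_, isHomogeneous_stairMonomial e⟩)
    span_range_stairMonomial hp
  have hempty : {q | q ∈ Set.range (stairMonomial K (d := d) (N := N)) ∧ q.IsHomogeneous n} =
      ∅ := by
    refine Set.eq_empty_of_forall_notMem ?_
    rintro _ ⟨⟨e, rfl⟩, he⟩
    refine hn.not_ge ((sum_eq_of_isHomogeneous_stairMonomial he).ge.trans ?_)
    exact Finset.sum_le_sum fun x _ => (e x).is_le
  rwa [hempty, Submodule.span_empty, bot_sup_eq, Submodule.restrictScalars_mem] at hmem

theorem mem_span_stairMonomial_last_sup {p : Wave K d N} (hp : p.IsHomogeneous (topGrade d N)) :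
    p ∈ Submodule.span K {stairMonomial K fun x : Fin d × Fin N => Fin.last (x.2 : ℕ)} ⊔
      (hilbertIdeal (sepSymm K d N)).restrictScalars K := by
  have hmem := mem_span_isHomogeneous_sup isGraded_sepSymm
    (Set.forall_mem_range.2 fun e => ⟨_, isHomogeneous_stairMonomial e⟩)
    span_range_stairMonomial hp
  refine (sup_le_sup_right (Submodule.span_mono ?_) _ : _ ≤ (_ : Submodule K _)) hmem
  rintro _ ⟨⟨e, rfl⟩, he⟩
  have hsum := sum_eq_of_isHomogeneous_stairMonomial he
  refine congrArg (stairMonomial K) (funext fun x => Fin.ext ?_)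
  exact (Finset.sum_eq_sum_iff_of_le fun x _ => (e x).is_le).1 hsum x (Finset.mem_univ x)

theorem exists_sub_C_mul_vandermondeProd_mem (hN : (N.factorial : K) ≠ 0) {p : Wave K d N}
    (hp : p.IsHomogeneous (topGrade d N)) :
    ∃ c : K, p - C c * vandermondeProd K d N ∈ hilbertIdeal (sepSymm K d N) := by
  let P := (hilbertIdeal (sepSymm K d N)).restrictScalars K
  let t : Wave K d N := stairMonomial K fun x => Fin.last (x.2 : ℕ)
  have ht : ∀ q : Wave K d N, q.IsHomogeneous (topGrade d N) →
      q ∈ Submodule.span K (insert t (P : Set (Wave K d N))) := fun q hq => by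
    rw [Submodule.span_insert, Submodule.span_eq]
    exact mem_span_stairMonomial_last_sup hq
  have hΔ := mem_span_insert_exchange (ht _ isHomogeneous_vandermondeProd) (by
    rw [Submodule.span_eq]
    exact vandermondeProd_notMem_hilbertIdeal hN)
  have hpΔ : p ∈ Submodule.span K (insert (vandermondeProd K d N) (P : Set (Wave K d N))) :=
    Submodule.span_le.2 (Set.insert_subset hΔ ((Set.subset_insert _ _).trans
      Submodule.subset_span)) (ht p hp)
  obtain ⟨c, z, hz, rfl⟩ := Submodule.mem_span_insert.1 hpΔ
  rw [Submodule.span_eq] at hz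
  refine ⟨c, ?_⟩
  rwa [smul_eq_C_mul, add_sub_cancel_left]

end Staircase

end FermionShapes

open FermionShapes in
theorem proposition3_general {K : Type*} [Field K] (d N : ℕ) (hd : Odd d)
    (hN : (N.factorial : K) ≠ 0) :
    (∃ (r : ℕ) (Ψ : Module.Basis (Fin r) (sepSymm K d N) (antisymm K d N)), IsShapeSystem Ψ) ∧
    ∀ {ι : Type*} (Ψ : Module.Basis ι (sepSymm K d N) (antisymm K d N)), IsShapeSystem Ψ →
      ∃ i : ι,
        (Ψ i : Wave K d N).IsHomogeneous (d * N * (N - 1) / 2) ∧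
        (∀ j : ι, j ≠ i → (Ψ j : Wave K d N).totalDegree < d * N * (N - 1) / 2) ∧
        (∃ c : K, c ≠ 0 ∧
          (Ψ i : Wave K d N) - C c * vandermondeProd K d N ∈ excitations K d N) ∧
        ∃ Ψ' : Module.Basis ι (sepSymm K d N) (antisymm K d N),
          IsShapeSystem Ψ' ∧ (Ψ' i : Wave K d N) = vandermondeProd K d N ∧
          ∀ j : ι, j ≠ i → Ψ' j = Ψ j := by
  obtain ⟨e, he, hhom⟩ := exists_isProj_antisymm (d := d) hN
  let Δ : antisymm K d N := ⟨vandermondeProd K d N, vandermondeProd_mem_antisymm hd⟩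
  have hΔ : (Δ : Wave K d N).IsHomogeneous (topGrade d N) := isHomogeneous_vandermondeProd
  refine ⟨exists_basis_isHomogeneous_of_isProj isGraded_sepSymm he hhom coordPermAlgHom_injective
    span_range_stairMonomial card_stairs.le, fun Ψ hΨ => ?_⟩
  choose n hn using hΨ
  obtain ⟨i, hni, hunit⟩ := exists_isUnit_repr_of_notMem_hilbertIdeal isGraded_sepSymm he Ψ hn hΔ
    (vandermondeProd_notMem_hilbertIdeal hN)
  obtain ⟨c, hc⟩ := exists_sub_C_mul_vandermondeProd_mem hN (hni ▸ hn i)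
  obtain ⟨Ψ', hΨ', hΨ'i, hΨ'j⟩ := exists_basis_isHomogeneous_replace Ψ (fun i => ⟨_, hn i⟩)
    ⟨_, hΔ⟩ hunit
  rw [← topGrade_eq]
  refine ⟨i, hni ▸ hn i, fun j hj => ?_, ⟨c, ne_zero_of_basis_sub_C_mul_mem he Ψ hc,
    sub_C_mul_mem_posIdeal_smul he (y := Δ) hc⟩, Ψ', hΨ', congrArg Subtype.val hΨ'i, hΨ'j⟩
  have hle : n j ≤ topGrade d N := not_lt.1 fun hlt =>
    basis_notMem_hilbertIdeal he Ψ j (mem_hilbertIdeal_of_topGrade_lt (hn j) hlt)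
  have hne : n j ≠ topGrade d N := fun h =>
    have ⟨_, hb⟩ := exists_sub_C_mul_vandermondeProd_mem hN (h ▸ hn j)
    hj (eq_of_basis_sub_C_mul_mem he Ψ hunit hb)
  exact (hn j).totalDegree_le.trans_lt (hle.lt_of_ne hne)

theorem proposition3 {K : Type*} [Field K] [CharZero K] (d N : ℕ) (hd : Odd d) :
    (∃ (r : ℕ) (Ψ : Module.Basis (Fin r) (FermionShapes.sepSymm K d N)
        (FermionShapes.antisymm K d N)), FermionShapes.IsShapeSystem Ψ) ∧
    ∀ {ι : Type*} (Ψ : Module.Basis ι (FermionShapes.sepSymm K d N)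
        (FermionShapes.antisymm K d N)), FermionShapes.IsShapeSystem Ψ →
      ∃ i : ι,
        (Ψ i : FermionShapes.Wave K d N).IsHomogeneous (d * N * (N - 1) / 2) ∧
        (∀ j : ι, j ≠ i →
          (Ψ j : FermionShapes.Wave K d N).totalDegree < d * N * (N - 1) / 2) ∧
        (∃ c : K, c ≠ 0 ∧
          (Ψ i : FermionShapes.Wave K d N) - C c * FermionShapes.vandermondeProd K d N
            ∈ FermionShapes.excitations K d N) ∧
        ∃ Ψ' : Module.Basis ι (FermionShapes.sepSymm K d N) (FermionShapes.antisymm K d N),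
          FermionShapes.IsShapeSystem Ψ' ∧
          (Ψ' i : FermionShapes.Wave K d N) = FermionShapes.vandermondeProd K d N ∧
          ∀ j : ι, j ≠ i → Ψ' j = Ψ j :=
  proposition3_general d N hd (Nat.cast_ne_zero.2 N.factorial_ne_zero)
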